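/- All Banach spaces and Banach lattices are real. For a Banach lattice $X$, let $\mathrm{Hom}(X,\mathbb{R})$ be the set of all bounded linear functionals $x^*$ on $X$ with $x^*(x\vee y)=x^*(x)\vee x^*(y)$ and $x^*(x\wedge y)=x^*(x)\wedge x^*(y)$ for all $x,y\in X$. For a compact Hausdorff space $K$, let $C(K,X)$ be the Banach lattice of all continuous functions from $K$ to $X$, with the supremum norm and the pointwise order. (1) Let $X$ be a Banach lattice such that $\mathrm{Hom}(X,\mathbb{R})=\{0\}$, and let $K$ be a compact Hausdorff space. Then $\mathrm{Hom}(C(K,X),\mathbb{R})=\{0\}$. (2) In particular, every separable Banach lattice embeds lattice-isometrically into a Banach lattice on which there are no nonzero real lattice homomorphisms. More precisely, let $\Delta$ be the Cantor set and let $L_1[0,1]$ be taken with respect to Lebesgue measure. Then $C(\Delta,L_1[0,1])$ is a Banach lattice with $\mathrm{Hom}(C(\Delta,L_1[0,1]),\mathbb{R})=\{0\}$, and for every separable Banach lattice $X$ there is a linear isometry $T\colon X\to C(\Delta,L_1[0,1])$ with $T(x\vee y)=Tx\vee Ty$ and $T(x\wedge y)=Tx\wedge Ty$ for all $x,y\in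 X$. -/

import Mathlib

open MeasureTheory

universe u v w

/-- A (real) Banach lattice: a complete real normed space with a lattice order which is compatible
with the vector space operations and whose norm is solid (`|x| ≤ |y| → ‖x‖ ≤ ‖y‖`). -/
class IsBanachLattice (X : Type u) [NormedAddCommGroup X] [NormedSpace ℝ X] [Lattice X] : Prop
    extends CompleteSpace X, HasSolidNorm X, IsOrderedAddMonoid X, IsOrderedModule ℝ X

/-- A bounded linear operator between Banach lattices is a lattice homomorphism if it preserves
binary suprema and infima. -/
def IsLatticeHomomorphism {X : Type u} {Y : Type v} [NormedAddCommGroup X] [NormedSpace ℝ X]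
    [Lattice X] [NormedAddCommGroup Y] [NormedSpace ℝ Y] [Lattice Y] (T : X →L[ℝ] Y) : Prop :=
  (∀ x y : X, T (x ⊔ y) = T x ⊔ T y) ∧ (∀ x y : X, T (x ⊓ y) = T x ⊓ T y)

/-- `Hom(X, ℝ)`: the set of all functionals in the dual of `X` that are lattice homomorphisms. -/
def RealLatticeHom (X : Type u) [NormedAddCommGroup X] [NormedSpace ℝ X] [Lattice X] :
    Set (X →L[ℝ] ℝ) :=
  {φ | IsLatticeHomomorphism φ}

/-- A linear isometry which preserves the lattice operations. -/
def IsLatticeIsometricEmbedding {X : Type u} {Y : Type v} [NormedAddCommGroup X] [NormedSpace ℝ X]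
    [Lattice X] [NormedAddCommGroup Y] [NormedSpace ℝ Y] [Lattice Y] (T : X →L[ℝ] Y) : Prop :=
  Isometry T ∧ IsLatticeHomomorphism T

/-- The space `C(K, X)`, with Mathlib's supremum norm and pointwise order, is a Banach lattice. -/
instance ContinuousMap.isBanachLattice (K : Type v) [TopologicalSpace K] [CompactSpace K]
    (X : Type u) [NormedAddCommGroup X] [NormedSpace ℝ X] [Lattice X] [IsBanachLattice X] :
    IsBanachLattice C(K, X) where
  toCompleteSpace := inferInstance
  solid := by
    intro f g h
    refine (ContinuousMap.norm_le f (norm_nonneg g)).2 fun t => ?_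
    have ht : |f t| ≤ |g t| := h t
    exact (HasSolidNorm.solid ht).trans (g.norm_coe_le_norm t)
  add_le_add_left := fun f g h k t => add_le_add_left (h t) (k t)
  smul_le_smul_of_nonneg_left := fun a ha f g h t =>
    smul_le_smul_of_nonneg_left (h t) ha
  smul_le_smul_of_nonneg_right := fun f hf a b h t =>
    smul_le_smul_of_nonneg_right h (hf t)

/-- The Banach lattice `L₁[0,1]` for Lebesgue measure, with the norm `∫ |f|` and the almost
everywhere order. -/
abbrev L1Interval : Type := Lp ℝ 1 (volume.restrict (Set.Icc (0 : ℝ) 1))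

instance L1Interval.isBanachLattice : IsBanachLattice L1Interval where
  toCompleteSpace := inferInstance
  solid := HasSolidNorm.solid
  add_le_add_left := fun _ _ h _ => add_le_add_left h _
  smul_le_smul_of_nonneg_left := by
    intro a ha f g h
    rw [← Lp.coeFn_le] at h ⊢
    filter_upwards [Lp.coeFn_smul a f, Lp.coeFn_smul a g, h] with x h1 h2 h3
    rw [h1, h2]
    exact smul_le_smul_of_nonneg_left h3 ha
  smul_le_smul_of_nonneg_right := by
    intro f hf a b h
    rw [← Lp.coeFn_nonneg] at hf
    rw [← Lp.coeFn_le]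
    filter_upwards [Lp.coeFn_smul a f, Lp.coeFn_smul b f, hf] with x h1 h2 h3
    rw [h1, h2]
    exact smul_le_smul_of_nonneg_right h h3

/-- The Cantor set is compact. -/
instance cantorSet.instCompactSpace : CompactSpace cantorSet :=
  isCompact_iff_compactSpace.1 isCompact_cantorSet

/-- The Banach lattice `C(Δ, L₁[0,1])`, where `Δ` is the Cantor set. -/
abbrev CantorL1 : Type := C(cantorSet, L1Interval)

/-!
A lattice homomorphism `φ` on `C(K, X)` lives at a single point of `K`: otherwise every point `t`
would have a neighbourhood on which some function not killed by `φ` vanishes, and by compactness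
finitely many of their absolute values would have infimum `0`. So `φ` factors through the evaluation
at some `t`, and the resulting lattice homomorphism on `X` is zero. For `X = L₁[0,1]` and `0 ≤ f`,
the number `φ (1_(-∞,t] f)` depends continuously on `t` and takes only the values `0` and `φ f`,
because `1_(-∞,t] f` and `1_(t,∞) f` are disjoint; as it tends to `0` at `-∞` and to `φ f` at `∞`,
it follows that `φ f = 0`.

For the embedding, a separable Banach lattice contains a dense vector sublattice `V` which is
countably generated and has an order unit `e` of norm at most one. The real Riesz homomorphisms on
`V` taking the value `1` at `e` form a compact metrizable space and separate points. As a continuous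
image of the Cantor set `Δ`, this space embeds `V` into `C(Δ)`. The positive functionals `ν` on
`C(Δ)` which are dominated on `V` by the norm of `V` again form a compact metrizable space, hence a
continuous family `ν z` indexed by `z ∈ Δ`, and by Hahn–Banach `‖x‖ = max_z ν z |x|` for `x ∈ V`.
The order of `Δ ⊆ ℝ` now provides the quantile transform of `ν z`, a measurable map from a
subinterval of `[0,1]` to `Δ` which pushes Lebesgue measure forward to `ν z`. Composition with it is
a Riesz homomorphism `Φ z : C(Δ) → L₁[0,1]` with `‖Φ z f‖ = ν z |f|`. It depends continuously on `z`
because it sends the indicator of an initial segment of `Δ` to that of an interval `[0, c]`, where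
`c` is the `ν z`-mass of the segment, and those indicators span a dense subspace. Hence
`x ↦ (z ↦ Φ z x)` is a lattice isometry from `V` into `C(Δ, L₁[0,1])`, and it extends by continuity.
-/

section RieszHom

variable {V W : Type*} [AddCommGroup V] [Module ℝ V] [Lattice V]
  [AddCommGroup W] [Module ℝ W] [Lattice W]

/-- A Riesz homomorphism is a linear map between vector lattices which preserves binary suprema.
Preservation of infima is then automatic, see `IsRieszHom.map_inf`. -/
def IsRieszHom (T : V →ₗ[ℝ] W) : Prop :=
  ∀ x y, T (x ⊔ y) = T x ⊔ T y

namespace IsRieszHom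

variable {T : V →ₗ[ℝ] W}

theorem monotone (hT : IsRieszHom T) : Monotone T := fun x y hxy => by
  rw [← sup_eq_right, ← hT, sup_eq_right.2 hxy]

theorem map_abs (hT : IsRieszHom T) (x : V) : T |x| = |T x| := by
  rw [abs, hT, map_neg, abs]

theorem map_inf [IsOrderedAddMonoid V] [IsOrderedAddMonoid W] (hT : IsRieszHom T) (x y : V) :
    T (x ⊓ y) = T x ⊓ T y := by
  rw [← neg_inj, ← map_neg, neg_inf, hT, map_neg, map_neg, neg_inf]

theorem le_iff_le (hT : IsRieszHom T) (hT_inj : Function.Injective T) {x y : V} :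
    T x ≤ T y ↔ x ≤ y := by
  rw [← sup_eq_right, ← hT, hT_inj.eq_iff, sup_eq_right]

end IsRieszHom

theorem isLatticeHomomorphism_of_isRieszHom {X : Type u} {Y : Type v}
    [NormedAddCommGroup X] [NormedSpace ℝ X] [Lattice X] [IsOrderedAddMonoid X]
    [NormedAddCommGroup Y] [NormedSpace ℝ Y] [Lattice Y] [IsOrderedAddMonoid Y]
    {T : X →L[ℝ] Y} (hT : IsRieszHom T.toLinearMap) : IsLatticeHomomorphism T :=
  ⟨hT, hT.map_inf⟩

theorem realLatticeHom_eq_zero_iff {X : Type u} [NormedAddCommGroup X] [NormedSpace ℝ X]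
    [Lattice X] : RealLatticeHom X = {0} ↔ ∀ φ : X →L[ℝ] ℝ, IsLatticeHomomorphism φ → φ = 0 := by
  have zero_mem : (0 : X →L[ℝ] ℝ) ∈ RealLatticeHom X := ⟨by simp, by simp⟩
  exact ⟨fun h φ hφ => h.subset hφ,
    fun h => Set.eq_singleton_iff_unique_mem.2 ⟨zero_mem, h⟩⟩

end RieszHom

section Evaluation

theorem exists_norm_le_eventually_eq {E : Type*} [NormedAddCommGroup E] [NormedSpace ℝ E]
    {K : Type*} [TopologicalSpace K] [CompactSpace K] (F : C(K, E)) {t : K} (ht : F t = 0)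
    {ε : ℝ} (hε : 0 < ε) : ∃ G : C(K, E), ‖G‖ ≤ ε ∧ ∀ᶠ s in nhds t, G s = F s := by
  have max_pos (s : K) : 0 < max ‖F s‖ ε := lt_max_of_lt_right hε
  have continuous_cutoff : Continuous fun s => ε / max ‖F s‖ ε :=
    continuous_const.div (by fun_prop) fun s => (max_pos s).ne'
  refine ⟨⟨fun s => (ε / max ‖F s‖ ε) • F s, continuous_cutoff.smul F.continuous⟩, ?_, ?_⟩
  · refine (ContinuousMap.norm_le _ hε.le).2 fun s => ?_
    rw [ContinuousMap.coe_mk, norm_smul, Real.norm_of_nonneg (by positivity), div_mul_eq_mul_div,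
      div_le_iff₀ (max_pos s)]
    gcongr
    exact le_max_left _ _
  · have norm_lt : ∀ᶠ s in nhds t, ‖F s‖ < ε :=
      (F.continuous.norm.tendsto t).eventually_lt_const (by simpa [ht] using hε)
    filter_upwards [norm_lt] with s hs
    rw [ContinuousMap.coe_mk, max_eq_right hs.le, div_self hε.ne', one_smul]

variable {X : Type u} [NormedAddCommGroup X] [NormedSpace ℝ X] [Lattice X] [TopologicalLattice X]
  [IsOrderedAddMonoid X] {K : Type v} [TopologicalSpace K] [CompactSpace K]
  {φ : C(K, X) →L[ℝ] ℝ}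

/-- If every point `t` had a neighbourhood outside of which lives a function `F t` with
`φ (F t) ≠ 0`, a finite infimum of the functions `|F t|` would vanish identically while its image
under `φ`, being the minimum of the numbers `|φ (F t)|`, would not. -/
theorem IsLatticeHomomorphism.exists_apply_eq_zero_of_eventually_eq_zero [Nonempty K]
    (hφ : IsLatticeHomomorphism φ) :
    ∃ t : K, ∀ F : C(K, X), (∀ᶠ s in nhds t, F s = 0) → φ F = 0 := by
  by_contra! h
  choose F F_zero φF_ne using h
  obtain ⟨S, -, cover⟩ := isCompact_univ.elim_nhds_subcover _ fun t _ => F_zero t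
  have exists_zero (r : K) : ∃ t ∈ S, F t r = 0 := by simpa using cover (Set.mem_univ r)
  have S_nonempty : S.Nonempty := (exists_zero (Classical.arbitrary K)).imp fun _ h => h.1
  let G := S.inf' S_nonempty fun t => |F t|
  have G_nonneg : 0 ≤ G := Finset.le_inf' _ _ fun t _ => abs_nonneg _
  have G_nonpos : G ≤ 0 := fun r => by
    obtain ⟨t, ht, htr⟩ := exists_zero r
    have le_abs : G r ≤ |F t r| := Finset.inf'_le (fun t => |F t|) ht r
    simpa [htr] using le_abs
  have φG_eq : φ G = S.inf' S_nonempty fun t => |φ (F t)| := by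
    rw [Finset.apply_inf'_eq_inf'_comp S_nonempty _ hφ.2]
    exact Finset.inf'_congr _ rfl fun t _ => IsRieszHom.map_abs hφ.1 (F t)
  have φG_pos : 0 < φ G := by
    rw [φG_eq, Finset.lt_inf'_iff]
    exact fun t _ => abs_pos.2 (φF_ne t)
  exact φG_pos.ne' (by rw [G_nonpos.antisymm G_nonneg, map_zero])

theorem IsLatticeHomomorphism.exists_eq_apply_const [Nonempty K] (hφ : IsLatticeHomomorphism φ) :
    ∃ t : K, ∀ F : C(K, X), φ F = φ (ContinuousMap.const K (F t)) := by
  obtain ⟨t, local_at_t⟩ := hφ.exists_apply_eq_zero_of_eventually_eq_zero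
  have apply_eq_zero (F : C(K, X)) (hF : F t = 0) : φ F = 0 := by
    have norm_le (ε : ℝ) (hε : 0 < ε) : ‖φ F‖ ≤ ‖φ‖ * ε := by
      obtain ⟨G, G_le, hFG⟩ := exists_norm_le_eventually_eq F hF hε
      have φF_eq : φ F = φ G := by
        rw [← sub_eq_zero, ← map_sub]
        exact local_at_t _ (hFG.mono fun s hs => by simp [hs])
      rw [φF_eq]
      exact φ.le_opNorm_of_le G_le
    have tendsto_zero : Filter.Tendsto (fun ε => ‖φ‖ * ε) (nhdsWithin 0 (Set.Ioi 0)) (nhds 0) := by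
      simpa using ((continuous_const_mul ‖φ‖).tendsto 0).mono_left nhdsWithin_le_nhds
    exact norm_le_zero_iff.1 (ge_of_tendsto tendsto_zero
      (Filter.eventually_of_mem self_mem_nhdsWithin norm_le))
  refine ⟨t, fun F => sub_eq_zero.1 ?_⟩
  rw [← map_sub]
  exact apply_eq_zero _ (by simp)

theorem realLatticeHom_continuousMap_eq_zero (hX : RealLatticeHom X = {0}) :
    RealLatticeHom C(K, X) = {0} := by
  rw [realLatticeHom_eq_zero_iff] at hX ⊢
  intro φ hφ
  ext F
  rcases isEmpty_or_nonempty K with _ | _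
  · rw [Subsingleton.elim F 0, map_zero, map_zero]
  · obtain ⟨t, factors⟩ := hφ.exists_eq_apply_const
    let const : X →L[ℝ] C(K, X) := ContinuousLinearMap.const ℝ K
    have comp_eq_zero : φ.comp const = 0 :=
      hX _ ⟨fun x y => hφ.1 (const x) (const y), fun x y => hφ.2 (const x) (const y)⟩
    rw [factors F]
    exact DFunLike.congr_fun comp_eq_zero (F t)

end Evaluation

section IntegrableFunctions

open Filter Topology

theorem tendsto_toL1_indicator {α ι : Type*} [MeasurableSpace α] {μ : Measure α} {f : α → ℝ}
    (hf : Integrable f μ) {l : Filter ι} [l.IsCountablyGenerated] {s : ι → Set α} {t : Set α}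
    (hs : ∀ i, MeasurableSet (s i)) (ht : MeasurableSet t)
    (hst : ∀ᵐ x ∂μ, ∀ᶠ i in l, (x ∈ s i ↔ x ∈ t)) :
    Tendsto (fun i => (hf.indicator (hs i)).toL1) l (𝓝 (hf.indicator ht).toL1) := by
  have norm_sub_eq (i : ι) : ‖(hf.indicator (hs i)).toL1 - (hf.indicator ht).toL1‖ =
      ∫ x, ‖(s i).indicator f x - t.indicator f x‖ ∂μ := by
    rw [← Integrable.toL1_sub]
    exact L1.norm_of_fun_eq_integral_norm _
  rw [tendsto_iff_norm_sub_tendsto_zero, ← integral_zero α ℝ (μ := μ)]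
  simp only [norm_sub_eq]
  refine tendsto_integral_filter_of_dominated_convergence (fun x => ‖f x‖)
    (Eventually.of_forall fun i =>
      ((hf.indicator (hs i)).sub (hf.indicator ht)).norm.aestronglyMeasurable)
    (Eventually.of_forall fun i => Eventually.of_forall fun x => ?_) hf.norm ?_
  · by_cases hi : x ∈ s i <;> by_cases hx : x ∈ t <;> simp [hi, hx]
  · filter_upwards [hst] with x hx
    refine tendsto_const_nhds.congr' ?_
    filter_upwards [hx] with i hi
    rw [Set.indicator_eq_indicator hi rfl, sub_self, norm_zero]

theorem toL1_indicator_inf_sub {α : Type*} [MeasurableSpace α] {μ : Measure α} {f : Lp ℝ 1 μ}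
    (hf : 0 ≤ f) {s : Set α} (hs : MeasurableSet s) :
    ((L1.integrable_coeFn f).indicator hs).toL1 ⊓
      (f - ((L1.integrable_coeFn f).indicator hs).toL1) = 0 := by
  set g := ((L1.integrable_coeFn f).indicator hs).toL1
  refine Lp.ext ?_
  filter_upwards [Integrable.coeFn_toL1 ((L1.integrable_coeFn f).indicator hs),
    Lp.coeFn_zero ℝ 1 μ, Lp.coeFn_inf g (f - g), Lp.coeFn_sub f g, (Lp.coeFn_nonneg f).2 hf]
    with x g_eq zero_eq inf_eq sub_eq f_nonneg
  rw [inf_eq, Pi.inf_apply, sub_eq, Pi.sub_apply, g_eq, zero_eq]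
  by_cases hx : x ∈ s <;> simpa [hx] using f_nonneg

variable {μ : Measure ℝ} [NullSingletonClass μ] {f : ℝ → ℝ}

theorem continuous_toL1_indicator_Iic (hf : Integrable f μ) :
    Continuous fun t : ℝ => (hf.indicator (measurableSet_Iic (a := t))).toL1 := by
  refine continuous_iff_continuousAt.2 fun t => tendsto_toL1_indicator hf
    (fun _ => measurableSet_Iic) measurableSet_Iic ?_
  have ae_ne : ∀ᵐ x ∂μ, x ≠ t := by simp [ae_iff]
  filter_upwards [ae_ne] with x hx
  rcases hx.lt_or_gt with hx | hx
  · filter_upwards [lt_mem_nhds hx] with s hs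
    simp [hs.le, hx.le]
  · filter_upwards [gt_mem_nhds hx] with s hs
    simp [(show s < x from hs).not_ge, hx.not_ge]

theorem apply_eq_zero_of_isLatticeHomomorphism_of_nonneg {φ : Lp ℝ 1 μ →L[ℝ] ℝ}
    (hφ : IsLatticeHomomorphism φ) {f : Lp ℝ 1 μ} (hf : 0 ≤ f) : φ f = 0 := by
  have f_int := L1.integrable_coeFn f
  let g (t : ℝ) : Lp ℝ 1 μ := (f_int.indicator (measurableSet_Iic (a := t))).toL1
  have φg_continuous : Continuous (φ ∘ g) :=
    φ.continuous.comp (continuous_toL1_indicator_Iic f_int)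
  have φg_mem (t : ℝ) : φ (g t) ∈ ({0, φ f} : Set ℝ) := by
    have inf_eq : φ (g t) ⊓ (φ f - φ (g t)) = 0 := by
      rw [← map_sub, ← hφ.2, toL1_indicator_inf_sub hf measurableSet_Iic, map_zero]
    rcases min_choice (φ (g t)) (φ f - φ (g t)) with h | h
    · exact Or.inl (h ▸ inf_eq)
    · exact Or.inr (sub_eq_zero.1 (h ▸ inf_eq)).symm
  have g_tendsto_atBot : Tendsto g atBot (𝓝 0) := by
    have g_tendsto := tendsto_toL1_indicator f_int (l := atBot)
      (fun t => measurableSet_Iic (a := t)) MeasurableSet.empty <|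
      Eventually.of_forall fun x => (eventually_lt_atBot x).mono fun t ht => by simpa using ht
    simpa only [Set.indicator_empty', Integrable.toL1_zero] using g_tendsto
  have g_tendsto_atTop : Tendsto g atTop (𝓝 f) := by
    have g_tendsto := tendsto_toL1_indicator f_int (l := atTop)
      (fun t => measurableSet_Iic (a := t)) MeasurableSet.univ <|
      Eventually.of_forall fun x => (eventually_ge_atTop x).mono fun t ht => by simpa using ht
    simpa [g] using g_tendsto
  obtain ⟨c, -, φg_eq⟩ := isPreconnected_univ.eqOn_const_of_mapsTo (Set.toFinite _).isDiscrete
    φg_continuous.continuousOn (fun t _ => φg_mem t) (Set.insert_nonempty _ _)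
  have φg_tendsto (l : Filter ℝ) : Tendsto (φ ∘ g) l (𝓝 c) :=
    tendsto_const_nhds.congr fun t => (φg_eq (Set.mem_univ t)).symm
  have c_eq_zero : c = 0 := by
    simpa using tendsto_nhds_unique (φg_tendsto atBot) ((φ.continuous.tendsto 0).comp
      g_tendsto_atBot)
  rw [← c_eq_zero]
  exact tendsto_nhds_unique ((φ.continuous.tendsto f).comp g_tendsto_atTop) (φg_tendsto atTop)

theorem realLatticeHom_L1_eq_zero : RealLatticeHom (Lp ℝ 1 μ) = {0} := by
  refine realLatticeHom_eq_zero_iff.2 fun φ hφ => ?_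
  ext f
  have apply_abs := apply_eq_zero_of_isLatticeHomomorphism_of_nonneg hφ (abs_nonneg f)
  exact abs_eq_zero.1 ((IsRieszHom.map_abs hφ.1 f).symm.trans apply_abs)

end IntegrableFunctions

section OrderUnit

open Filter Topology

theorem apply_smul_eq_of_forall_le {E : Type*} [AddCommGroup E] [Module ℝ E] {N : E → ℝ}
    (hN : ∀ c : ℝ, 0 < c → ∀ x, N (c • x) ≤ c * N x) {c : ℝ} (hc : 0 < c) (x : E) :
    N (c • x) = c * N x := by
  have le := hN c⁻¹ (inv_pos.2 hc) (c • x)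
  rw [inv_smul_smul₀ hc.ne', le_inv_mul_iff₀ hc] at le
  exact (hN c hc x).antisymm le

variable {V : Type*} [AddCommGroup V] [Module ℝ V] [Lattice V]

/-- A functional on a vector lattice is max-sublinear if it is monotone, sublinear and satisfies
`p (x ⊔ y) ≤ max (p x) (p y)`. The linear functionals with this property are the real Riesz
homomorphisms. -/
structure IsMaxSublinear (p : V → ℝ) : Prop where
  monotone : Monotone p
  add_le : ∀ x y, p (x + y) ≤ p x + p y
  smul_le : ∀ c : ℝ, 0 ≤ c → ∀ x, p (c • x) ≤ c * p x
  sup_le : ∀ x y, p (x ⊔ y) ≤ max (p x) (p y)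

namespace IsMaxSublinear

variable {p : V → ℝ}

theorem apply_zero (hp : IsMaxSublinear p) : p 0 = 0 := by
  have nonneg := hp.add_le 0 0
  have nonpos := hp.smul_le 0 le_rfl 0
  simp only [add_zero, zero_smul, zero_mul] at nonneg nonpos
  linarith

theorem neg_apply_neg_le (hp : IsMaxSublinear p) (x : V) : -p (-x) ≤ p x := by
  have := hp.add_le x (-x)
  rw [add_neg_cancel, hp.apply_zero] at this
  linarith

theorem apply_smul (hp : IsMaxSublinear p) {c : ℝ} (hc : 0 ≤ c) (x : V) : p (c • x) = c * p x := by
  rcases hc.eq_or_lt with rfl | hc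
  · simp [hp.apply_zero]
  · exact apply_smul_eq_of_forall_le (fun c hc => hp.smul_le c hc.le) hc x

theorem of_tendsto {ι : Type*} {l : Filter ι} [l.NeBot] {F : ι → V → ℝ}
    (hF : ∀ i, IsMaxSublinear (F i)) (hp : ∀ x, Tendsto (fun i => F i x) l (𝓝 (p x))) :
    IsMaxSublinear p where
  monotone x y hxy := le_of_tendsto_of_tendsto' (hp x) (hp y) fun i => (hF i).monotone hxy
  add_le x y := le_of_tendsto_of_tendsto' (hp _) ((hp x).add (hp y)) fun i => (hF i).add_le x y
  smul_le c hc x :=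
    le_of_tendsto_of_tendsto' (hp _) ((hp x).const_mul c) fun i => (hF i).smul_le c hc x
  sup_le x y := le_of_tendsto_of_tendsto' (hp _) ((hp x).max (hp y)) fun i => (hF i).sup_le x y

theorem exists_lowerBound_of_isChain {c : Set (V → ℝ)} (hc : ∀ p ∈ c, IsMaxSublinear p)
    (chain : IsChain (· ≤ ·) c) (hne : c.Nonempty) :
    ∃ q, IsMaxSublinear q ∧ ∀ p ∈ c, q ≤ p := by
  obtain ⟨p₀, hp₀⟩ := hne
  have : Nonempty c := ⟨⟨p₀, hp₀⟩⟩
  have : IsCodirectedOrder c := ⟨fun p q => (chain.total p.2 q.2).elim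
    (fun h => ⟨p, le_rfl, h⟩) fun h => ⟨q, h, le_rfl⟩⟩
  have bddBelow (x : V) : BddBelow (Set.range fun p : c => p.1 x) := by
    refine ⟨-p₀ (-x), ?_⟩
    rintro _ ⟨⟨p, hp⟩, rfl⟩
    rcases chain.total hp hp₀ with h | h
    · exact (neg_le_neg (h (-x))).trans ((hc p hp).neg_apply_neg_le x)
    · exact ((hc p₀ hp₀).neg_apply_neg_le x).trans (h x)
  exact ⟨fun x => ⨅ p : c, p.1 x,
    of_tendsto (fun p : c => hc p.1 p.2) fun x =>
      tendsto_atBot_ciInf (fun _ _ h => Subtype.coe_le_coe.2 h x) (bddBelow x),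
    fun p hp x => ciInf_le (bddBelow x) ⟨p, hp⟩⟩

theorem exists_minimal_le (hp : IsMaxSublinear p) :
    ∃ q ≤ p, Minimal (IsMaxSublinear (V := V)) q := by
  obtain ⟨q, hqp, hq⟩ := zorn_le_nonempty₀ (α := (V → ℝ)ᵒᵈ) {q | IsMaxSublinear q.ofDual}
    (fun c hc chain q hq => exists_lowerBound_of_isChain hc chain.symm ⟨q, hq⟩) (.toDual p) hp
  exact ⟨q, hqp, hq⟩

/-- The functional `z ↦ lim_{t → ∞} (p (z + t • x) - t * p x)` is max-sublinear and additive in the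
direction of `x`. -/
theorem exists_le_apply_neg_le [IsOrderedAddMonoid V] (hp : IsMaxSublinear p) (x : V) :
    ∃ q ≤ p, IsMaxSublinear q ∧ q (-x) ≤ -p x := by
  let f (z : V) (t : ℝ) : ℝ := p (z + t • x) - t * p x
  have f_antitone (z : V) : Antitone (f z) := fun s t hst => by
    have add_le := hp.add_le (z + s • x) ((t - s) • x)
    have smul_le := hp.smul_le (t - s) (sub_nonneg.2 hst) x
    rw [show z + s • x + (t - s) • x = z + t • x by module] at add_le
    linarith
  have f_bddBelow (z : V) : BddBelow (Set.range (f z)) := by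
    refine ⟨-p (-z), ?_⟩
    rintro _ ⟨t, rfl⟩
    refine le_trans ?_ (f_antitone z (le_max_left t 0))
    have add_le := hp.add_le (z + max t 0 • x) (-z)
    rw [add_neg_cancel_comm, hp.apply_smul (le_max_right t 0)] at add_le
    linarith
  let q (z : V) : ℝ := ⨅ t, f z t
  have f_tendsto (z : V) : Tendsto (f z) atTop (𝓝 (q z)) :=
    tendsto_atTop_ciInf (f_antitone z) (f_bddBelow z)
  have q_le (z : V) (t : ℝ) : q z ≤ f z t := ciInf_le (f_bddBelow z) t
  refine ⟨q, fun z => by simpa [f] using q_le z 0, ⟨fun y z hyz => ?_, fun y z => ?_,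
    fun c hc z => ?_, fun y z => ?_⟩, ?_⟩
  · exact ciInf_mono (f_bddBelow y) fun t =>
      sub_le_sub_right (hp.monotone (add_le_add_left hyz _)) _
  · refine ge_of_tendsto' ((f_tendsto y).add (f_tendsto z)) fun t => (q_le _ (t + t)).trans ?_
    have add_le := hp.add_le (y + t • x) (z + t • x)
    rw [show y + t • x + (z + t • x) = y + z + (t + t) • x by module] at add_le
    simp only [f]
    linarith
  · refine ge_of_tendsto' ((f_tendsto z).const_mul c) fun t => (q_le _ (c * t)).trans ?_
    have smul_le := hp.smul_le c hc (z + t • x)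
    rw [smul_add, smul_smul] at smul_le
    simp only [f]
    linarith
  · refine le_of_tendsto_of_tendsto' (f_tendsto _) ((f_tendsto y).max (f_tendsto z)) fun t => ?_
    simp only [f, max_sub_sub_right, sup_add]
    exact sub_le_sub_right (hp.sup_le _ _) _
  · simpa [f, hp.apply_zero] using q_le (-x) 1

/-- Minimality makes `p` additive in every direction, that is, linear. -/
theorem exists_isRieszHom_of_minimal [IsOrderedAddMonoid V] (hp : Minimal IsMaxSublinear p) :
    ∃ ω : V →ₗ[ℝ] ℝ, IsRieszHom ω ∧ ⇑ω = p := by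
  have hp' := hp.prop
  have apply_neg (x : V) : p (-x) = -p x := by
    obtain ⟨q, q_le, hq, q_neg_le⟩ := hp'.exists_le_apply_neg_le x
    exact ((hp.le_of_le hq q_le (-x)).trans q_neg_le).antisymm
      (neg_le.1 (hp'.neg_apply_neg_le x))
  have apply_add (x y : V) : p (x + y) = p x + p y := by
    refine (hp'.add_le x y).antisymm ?_
    have := hp'.add_le (-x) (-y)
    rw [← neg_add, apply_neg, apply_neg, apply_neg] at this
    linarith
  have apply_smul (c : ℝ) (x : V) : p (c • x) = c * p x := by
    rcases le_total 0 c with hc | hc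
    · exact hp'.apply_smul hc x
    · rw [← neg_neg (c • x), apply_neg, ← neg_smul, hp'.apply_smul (neg_nonneg.2 hc), neg_mul,
        neg_neg]
  exact ⟨⟨⟨p, apply_add⟩, apply_smul⟩, fun x y => (hp'.sup_le x y).antisymm
    (_root_.sup_le (hp'.monotone le_sup_left) (hp'.monotone le_sup_right)), rfl⟩

theorem exists_isRieszHom_le_apply_le [IsOrderedAddMonoid V] (hp : IsMaxSublinear p) (x : V) :
    ∃ ω : V →ₗ[ℝ] ℝ, IsRieszHom ω ∧ (∀ y, ω y ≤ p y) ∧ p x ≤ ω x := by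
  obtain ⟨q, q_le, hq, q_neg_le⟩ := hp.exists_le_apply_neg_le x
  obtain ⟨r, r_le, hr⟩ := hq.exists_minimal_le
  obtain ⟨ω, hω, rfl⟩ := exists_isRieszHom_of_minimal hr
  refine ⟨ω, hω, fun y => (r_le y).trans (q_le y), neg_le_neg_iff.1 ?_⟩
  rw [← map_neg]
  exact (r_le (-x)).trans q_neg_le

end IsMaxSublinear

/-- An Archimedean order unit is a nonnegative element `e` such that every element lies below a
multiple of `e`, and every element lying below all positive multiples of `e` is nonpositive. -/
structure IsArchimedeanOrderUnit (e : V) : Prop where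
  nonneg : 0 ≤ e
  exists_le_smul : ∀ x, ∃ c : ℝ, x ≤ c • e
  nonpos_of_forall_le_smul : ∀ x, (∀ ε : ℝ, 0 < ε → x ≤ ε • e) → x ≤ 0

/-- The gauge of an order unit `e`: the least `c` with `x ≤ c • e`. -/
noncomputable def orderUnitGauge (e x : V) : ℝ :=
  sInf {c : ℝ | x ≤ c • e}

namespace IsArchimedeanOrderUnit

variable [IsOrderedAddMonoid V] [IsOrderedModule ℝ V] {e : V}

theorem orderUnitGauge_le_iff (he : IsArchimedeanOrderUnit e) (he₀ : e ≠ 0) {x : V} {c : ℝ} :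
    orderUnitGauge e x ≤ c ↔ x ≤ c • e := by
  have bddBelow : BddBelow {c : ℝ | x ≤ c • e} := by
    obtain ⟨d, hd⟩ := he.exists_le_smul (-x)
    refine ⟨-d, fun c hc => le_of_not_gt fun hcd => he₀ (le_antisymm ?_ he.nonneg)⟩
    have smul_nonneg : 0 ≤ (c + d) • e := by
      simpa [add_smul] using add_le_add (show x ≤ c • e from hc) hd
    rwa [← smul_zero (c + d), smul_le_smul_iff_of_neg_left (by linarith)] at smul_nonneg
  refine ⟨fun h => sub_nonpos.1 (he.nonpos_of_forall_le_smul _ fun ε hε => ?_),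
    fun h => csInf_le bddBelow h⟩
  obtain ⟨d, hd, hdε⟩ := exists_lt_of_csInf_lt (he.exists_le_smul x)
    (h.trans_lt (lt_add_of_pos_right c hε))
  rw [sub_le_iff_le_add, ← add_smul, add_comm]
  exact (show x ≤ d • e from hd).trans (smul_le_smul_of_nonneg_right hdε.le he.nonneg)

theorem isMaxSublinear_orderUnitGauge (he : IsArchimedeanOrderUnit e) (he₀ : e ≠ 0) :
    IsMaxSublinear (orderUnitGauge e) := by
  have le_iff {x : V} {c : ℝ} := he.orderUnitGauge_le_iff he₀ (x := x) (c := c)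
  have le_gauge (x : V) : x ≤ orderUnitGauge e x • e := le_iff.1 le_rfl
  refine ⟨fun x y hxy => le_iff.2 (hxy.trans (le_gauge y)), fun x y => ?_, fun c hc x => ?_,
    fun x y => ?_⟩
  · rw [le_iff, add_smul]
    exact add_le_add (le_gauge x) (le_gauge y)
  · rw [le_iff, mul_smul]
    exact smul_le_smul_of_nonneg_left (le_gauge x) hc
  · exact le_iff.2 (_root_.sup_le (le_iff.1 (le_max_left _ _)) (le_iff.1 (le_max_right _ _)))

theorem exists_isRieszHom_apply_ne_zero (he : IsArchimedeanOrderUnit e) {x : V} (hx : x ≠ 0) :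
    ∃ ω : V →ₗ[ℝ] ℝ, IsRieszHom ω ∧ ω e = 1 ∧ ω x ≠ 0 := by
  have abs_not_nonpos : ¬|x| ≤ 0 := fun h => hx <|
    ((le_abs_self x).trans h).antisymm (neg_nonpos.1 ((neg_le_abs x).trans h))
  have he₀ : e ≠ 0 := by
    rintro rfl
    obtain ⟨c, hc⟩ := he.exists_le_smul |x|
    exact abs_not_nonpos (by simpa using hc)
  have le_iff {y : V} {c : ℝ} := he.orderUnitGauge_le_iff he₀ (x := y) (c := c)
  obtain ⟨ω, hω, ω_le, le_ω⟩ :=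
    (he.isMaxSublinear_orderUnitGauge he₀).exists_isRieszHom_le_apply_le |x|
  refine ⟨ω, hω, le_antisymm ?_ ?_, fun h => ?_⟩
  · exact (ω_le e).trans (le_iff.2 (one_smul ℝ e).ge)
  · have ω_neg_le : ω (-e) ≤ -1 := (ω_le (-e)).trans (le_iff.2 (by rw [neg_one_smul]))
    rwa [map_neg, neg_le_neg_iff] at ω_neg_le
  · rw [hω.map_abs, h, abs_zero, le_iff, zero_smul] at le_ω
    exact abs_not_nonpos le_ω

end IsArchimedeanOrderUnit

end OrderUnit

section CantorParametrization

theorem exists_cantorSet_continuous_surjective (S : Type*) [TopologicalSpace S] [CompactSpace S]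
    [TopologicalSpace.MetrizableSpace S] [Nonempty S] :
    ∃ σ : cantorSet → S, Continuous σ ∧ Function.Surjective σ := by
  let _ := TopologicalSpace.metrizableSpaceMetric S
  obtain ⟨g, g_continuous, g_surjective⟩ := exists_nat_bool_continuous_surjective_of_compact S
  exact ⟨g ∘ cantorSetHomeomorphNatToBool,
    g_continuous.comp cantorSetHomeomorphNatToBool.continuous,
    g_surjective.comp cantorSetHomeomorphNatToBool.surjective⟩

variable {V : Type*} [AddCommGroup V] [Module ℝ V]

theorem isCompact_inter_range_linearMap_of_le {C : Set (V → ℝ)} (hC : IsClosed C) (b : V → ℝ)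
    (hb : ∀ ω : V →ₗ[ℝ] ℝ, ⇑ω ∈ C → ∀ x, ω x ≤ b x) :
    IsCompact (C ∩ Set.range ((↑) : (V →ₗ[ℝ] ℝ) → V → ℝ)) := by
  refine (isCompact_univ_pi fun x => isCompact_Icc (a := -b (-x)) (b := b x)).of_isClosed_subset
    (hC.inter (LinearMap.isClosed_range_coe _ _ _)) ?_
  rintro _ ⟨hω, ω, rfl⟩ x -
  have apply_neg_le := hb ω hω (-x)
  rw [map_neg] at apply_neg_le
  exact ⟨neg_le.1 apply_neg_le, hb ω hω x⟩

theorem exists_cantorSet_continuous_range_eq {C : Set (V → ℝ)} (hC : IsClosed C) (b : V → ℝ)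
    (hb : ∀ ω : V →ₗ[ℝ] ℝ, ⇑ω ∈ C → ∀ x, ω x ≤ b x) (hne : ∃ ω : V →ₗ[ℝ] ℝ, ⇑ω ∈ C) (u : ℕ → V)
    (hu : ∀ ω ω' : V →ₗ[ℝ] ℝ, ⇑ω ∈ C → ⇑ω' ∈ C → (∀ n, ω (u n) = ω' (u n)) → ω = ω') :
    ∃ σ : cantorSet → V →ₗ[ℝ] ℝ,
      (∀ x, Continuous fun t => σ t x) ∧ Set.range σ = {ω : V →ₗ[ℝ] ℝ | ⇑ω ∈ C} := by
  let S := C ∩ Set.range ((↑) : (V →ₗ[ℝ] ℝ) → V → ℝ)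
  have : CompactSpace S :=
    isCompact_iff_compactSpace.1 (isCompact_inter_range_linearMap_of_le hC b hb)
  have : Nonempty S := hne.elim fun ω hω => ⟨⟨ω, hω, ω, rfl⟩⟩
  have eval_continuous (x : V) : Continuous fun ω : S => ω.1 x :=
    (continuous_apply x).comp continuous_subtype_val
  have separating : Pairwise fun ω ω' : S => ∃ n, ω.1 (u n) ≠ ω'.1 (u n) := by
    rintro ⟨_, hω, ω, rfl⟩ ⟨_, hω', ω', rfl⟩ hne
    by_contra! h
    exact hne (Subtype.ext (congrArg DFunLike.coe (hu ω ω' hω hω' h)))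
  have := Metric.PiNatEmbed.TopologicalSpace.MetrizableSpace.of_countable_separating
    (fun n (ω : S) => ω.1 (u n)) (fun n => eval_continuous (u n)) separating
  obtain ⟨g, g_continuous, g_surjective⟩ := exists_cantorSet_continuous_surjective S
  choose σ hσ using fun t => (g t).2.2
  refine ⟨σ, fun x => ?_, Set.Subset.antisymm ?_ fun ω hω => ?_⟩
  · simp only [hσ]
    exact (eval_continuous x).comp g_continuous
  · rintro _ ⟨t, rfl⟩
    rw [Set.mem_ofPred_eq, hσ]
    exact (g t).2.1
  · obtain ⟨t, ht⟩ := g_surjective ⟨ω, hω, ω, rfl⟩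
    exact ⟨t, DFunLike.coe_injective ((hσ t).trans (congrArg Subtype.val ht))⟩

variable [Lattice V] [IsOrderedAddMonoid V] [IsOrderedModule ℝ V] {e : V}

theorem IsArchimedeanOrderUnit.exists_injective_isRieszHom_cantorSet [Nontrivial V]
    (he : IsArchimedeanOrderUnit e) (u : ℕ → V)
    (hu : ∀ ω ω' : V →ₗ[ℝ] ℝ, IsRieszHom ω → IsRieszHom ω' → ω e = ω' e →
      (∀ n, ω (u n) = ω' (u n)) → ω = ω') :
    ∃ J : V →ₗ[ℝ] C(cantorSet, ℝ), IsRieszHom J ∧ J e = 1 ∧ Function.Injective J := by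
  let C : Set (V → ℝ) := (⋂ x, ⋂ y, {f | f (x ⊔ y) = f x ⊔ f y}) ∩ {f | f e = 1}
  have mem_C {ω : V →ₗ[ℝ] ℝ} : ⇑ω ∈ C ↔ IsRieszHom ω ∧ ω e = 1 := by simp [C, IsRieszHom]
  have C_closed : IsClosed C :=
    (isClosed_iInter fun x => isClosed_iInter fun y =>
      isClosed_eq (by fun_prop) (by fun_prop)).inter (isClosed_eq (by fun_prop) (by fun_prop))
  have exists_mem_C {x : V} (hx : x ≠ 0) : ∃ ω : V →ₗ[ℝ] ℝ, ⇑ω ∈ C ∧ ω x ≠ 0 := by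
    obtain ⟨ω, hω, ωe, ωx⟩ := he.exists_isRieszHom_apply_ne_zero hx
    exact ⟨ω, mem_C.2 ⟨hω, ωe⟩, ωx⟩
  choose b hb using he.exists_le_smul
  have apply_le (ω : V →ₗ[ℝ] ℝ) (hω : ⇑ω ∈ C) (x : V) : ω x ≤ b x := by
    have := (mem_C.1 hω).1.monotone (hb x)
    rwa [map_smul, (mem_C.1 hω).2, smul_eq_mul, mul_one] at this
  obtain ⟨x₀, hx₀⟩ := exists_ne (0 : V)
  obtain ⟨σ, σ_continuous, σ_range⟩ := exists_cantorSet_continuous_range_eq C_closed b apply_le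
    ((exists_mem_C hx₀).imp fun _ h => h.1) u fun ω ω' hω hω' =>
      hu ω ω' (mem_C.1 hω).1 (mem_C.1 hω').1 ((mem_C.1 hω).2.trans (mem_C.1 hω').2.symm)
  have σ_mem (t : cantorSet) : IsRieszHom (σ t) ∧ σ t e = 1 :=
    mem_C.1 (σ_range.subset (Set.mem_range_self t))
  let J : V →ₗ[ℝ] C(cantorSet, ℝ) :=
    { toFun x := ⟨fun t => σ t x, σ_continuous x⟩
      map_add' x y := by ext t; exact map_add (σ t) x y
      map_smul' c x := by ext t; exact map_smul (σ t) c x }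
  refine ⟨J, fun x y => ?_, ?_, (injective_iff_map_eq_zero J).2 fun x hx => ?_⟩
  · ext t
    exact (σ_mem t).1 x y
  · ext t
    exact (σ_mem t).2
  · by_contra hx₀
    obtain ⟨ω, hω, ωx⟩ := exists_mem_C hx₀
    obtain ⟨t, rfl⟩ := σ_range.superset hω
    exact ωx (DFunLike.congr_fun hx t)

end CantorParametrization

section Norming

theorem exists_linearMap_le_apply_eq {E : Type*} [AddCommGroup E] [Module ℝ E] {N : E → ℝ}
    (N_smul_le : ∀ c : ℝ, 0 < c → ∀ x, N (c • x) ≤ c * N x)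
    (N_add_le : ∀ x y, N (x + y) ≤ N x + N y) (x : E) :
    ∃ ν : E →ₗ[ℝ] ℝ, (∀ y, ν y ≤ N y) ∧ ν x = N x := by
  have N_smul (c : ℝ) (hc : 0 < c) (y : E) : N (c • y) = c * N y :=
    apply_smul_eq_of_forall_le N_smul_le hc y
  have N_zero : N 0 = 0 := by
    have := N_smul 2 two_pos 0
    rw [smul_zero] at this
    linarith
  have mul_le (c : ℝ) : c * N x ≤ N (c • x) := by
    rcases lt_trichotomy c 0 with hc | rfl | hc
    · have N_neg := N_smul (-c) (neg_pos.2 hc) x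
      have N_add := N_add_le (c • x) (-c • x)
      rw [← add_smul, add_neg_cancel, zero_smul, N_zero] at N_add
      linarith
    · simp [N_zero]
    · exact (N_smul c hc x).ge
  have well_defined (c : ℝ) (hc : c • x = 0) : c • N x = 0 := by
    rcases smul_eq_zero.1 hc with rfl | rfl
    · exact zero_smul ℝ _
    · rw [N_zero, smul_zero]
  let ν₀ : E →ₗ.[ℝ] ℝ := LinearPMap.mkSpanSingleton' x (N x) well_defined
  have ν₀_le (y : ν₀.domain) : ν₀ y ≤ N y := by
    obtain ⟨_, hy⟩ := y
    obtain ⟨c, rfl⟩ := Submodule.mem_span_singleton.1 hy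
    exact (LinearPMap.mkSpanSingleton'_apply _ _ well_defined c hy).trans_le (mul_le c)
  obtain ⟨ν, ν_eq, ν_le⟩ := exists_extension_of_le_sublinear ν₀ N N_smul N_add_le ν₀_le
  exact ⟨ν, ν_le, (ν_eq ⟨x, Submodule.mem_span_singleton_self x⟩).trans
    (LinearPMap.mkSpanSingleton'_apply_self _ _ well_defined _)⟩

variable {V : Type*} [NormedAddCommGroup V] [NormedSpace ℝ V]

section Majorants

variable {W : Type*} [AddCommGroup W] [Module ℝ W] [PartialOrder W] {J : V →ₗ[ℝ] W}

/-- The infimum of the norms of the elements of `V` whose image under `J` lies above `f`. When `J`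
is an order embedding, this extends the norm of the positive cone of `V`. -/
noncomputable def majorantNorm (J : V →ₗ[ℝ] W) (f : W) : ℝ :=
  ⨅ y : {y : V // f ≤ J y}, ‖y.1‖

theorem majorantNorm_le {f : W} {y : V} (hy : f ≤ J y) : majorantNorm J f ≤ ‖y‖ :=
  ciInf_le ⟨0, by rintro _ ⟨z, rfl⟩; exact norm_nonneg _⟩ (⟨y, hy⟩ : {y : V // f ≤ J y})

theorem majorantNorm_add_le [IsOrderedAddMonoid W] (cofinal : ∀ f, ∃ y, f ≤ J y) (f g : W) :
    majorantNorm J (f + g) ≤ majorantNorm J f + majorantNorm J g := by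
  have (f : W) : Nonempty {y : V // f ≤ J y} := nonempty_subtype.2 (cofinal f)
  refine le_ciInf_add_ciInf fun y z => (majorantNorm_le ?_).trans (norm_add_le y.1 z.1)
  rw [map_add]
  exact add_le_add y.2 z.2

theorem majorantNorm_smul_le [IsOrderedModule ℝ W] (cofinal : ∀ f, ∃ y, f ≤ J y) {c : ℝ}
    (hc : 0 < c) (f : W) : majorantNorm J (c • f) ≤ c * majorantNorm J f := by
  have : Nonempty {y : V // f ≤ J y} := nonempty_subtype.2 (cofinal f)
  refine (le_ciInf fun y => ?_).trans_eq (Real.mul_iInf_of_nonneg hc.le _).symm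
  have smul_le : c • f ≤ J (c • y.1) := by
    rw [map_smul]
    exact smul_le_smul_of_nonneg_left y.2 hc.le
  exact (majorantNorm_le smul_le).trans_eq (by rw [norm_smul, Real.norm_of_nonneg hc.le])

end Majorants

variable [Lattice V] [HasSolidNorm V] [IsOrderedAddMonoid V]

section RieszHom

variable {W : Type*} [AddCommGroup W] [Module ℝ W] [Lattice W] {J : V →ₗ[ℝ] W}

theorem majorantNorm_apply (hJ : IsRieszHom J) (hJ_inj : Function.Injective J) {x : V}
    (hx : 0 ≤ x) : majorantNorm J (J x) = ‖x‖ := by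
  have : Nonempty {y : V // J x ≤ J y} := ⟨⟨x, le_rfl⟩⟩
  refine (majorantNorm_le le_rfl).antisymm (le_ciInf fun y => norm_le_norm_of_abs_le_abs ?_)
  rw [abs_of_nonneg hx]
  exact ((hJ.le_iff_le hJ_inj).1 y.2).trans (le_abs_self _)

theorem exists_monotone_linearMap_apply_eq_norm [IsOrderedAddMonoid W] [IsOrderedModule ℝ W]
    (hJ : IsRieszHom J) (hJ_inj : Function.Injective J) (cofinal : ∀ f, ∃ y, f ≤ J y) {x : V}
    (hx : 0 ≤ x) :
    ∃ ν : W →ₗ[ℝ] ℝ, Monotone ν ∧ (∀ y, ν (J y) ≤ ‖y‖) ∧ ν (J x) = ‖x‖ := by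
  obtain ⟨ν, ν_le, νx⟩ := exists_linearMap_le_apply_eq (fun _ => majorantNorm_smul_le cofinal)
    (majorantNorm_add_le cofinal) (J x)
  have ν_nonpos (f : W) (hf : f ≤ 0) : ν f ≤ 0 :=
    (ν_le f).trans ((majorantNorm_le (hf.trans_eq J.map_zero.symm)).trans_eq norm_zero)
  refine ⟨ν, fun f g hfg => ?_, fun y => (ν_le _).trans (majorantNorm_le le_rfl),
    νx.trans (majorantNorm_apply hJ hJ_inj hx)⟩
  rw [← sub_nonpos, ← map_sub]
  exact ν_nonpos _ (sub_nonpos.2 hfg)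

end RieszHom

variable {K : Type*} [TopologicalSpace K]

/-- A quasi-state on `C(K, ℝ)` is a positive functional of norm at most one, that is, the integral
with respect to a subprobability measure on `K`. -/
structure IsQuasistate (ν : C(K, ℝ) →ₗ[ℝ] ℝ) : Prop where
  monotone : Monotone ν
  apply_one_le : ν 1 ≤ 1

variable [CompactSpace K]

theorem le_norm_smul_one (f : C(K, ℝ)) : f ≤ ‖f‖ • 1 := fun t => by
  simpa using (le_abs_self _).trans (f.norm_coe_le_norm t)

theorem IsQuasistate.apply_le_norm {ν : C(K, ℝ) →ₗ[ℝ] ℝ} (hν : IsQuasistate ν) (f : C(K, ℝ)) :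
    ν f ≤ ‖f‖ :=
  calc ν f ≤ ‖f‖ * ν 1 := (hν.monotone (le_norm_smul_one f)).trans_eq (map_smul ν _ _)
    _ ≤ ‖f‖ := mul_le_of_le_one_right (norm_nonneg f) hν.apply_one_le

theorem IsQuasistate.continuous {ν : C(K, ℝ) →ₗ[ℝ] ℝ} (hν : IsQuasistate ν) : Continuous ν :=
  AddMonoidHomClass.continuous_of_bound ν 1 fun f => by
    have apply_neg_le := hν.apply_le_norm (-f)
    rw [map_neg, norm_neg] at apply_neg_le
    rw [one_mul, Real.norm_eq_abs, abs_le]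
    exact ⟨neg_le.1 apply_neg_le, hν.apply_le_norm f⟩

theorem exists_cantorSet_quasistates_norming [TopologicalSpace.SeparableSpace C(K, ℝ)]
    {J : V →ₗ[ℝ] C(K, ℝ)} (hJ : IsRieszHom J)
    (hJ_inj : Function.Injective J) {e : V} (hJe : J e = 1) (he : ‖e‖ ≤ 1) :
    ∃ ν : cantorSet → C(K, ℝ) →ₗ[ℝ] ℝ, (∀ z, IsQuasistate (ν z)) ∧
      (∀ f, Continuous fun z => ν z f) ∧ (∀ z y, ν z (J y) ≤ ‖y‖) ∧
      ∀ x, ∃ z, ν z |J x| = ‖x‖ := by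
  let C : Set (C(K, ℝ) → ℝ) := {ν | Monotone ν} ∩ ⋂ y : V, {ν | ν (J y) ≤ ‖y‖}
  have mem_C {ν : C(K, ℝ) →ₗ[ℝ] ℝ} : ⇑ν ∈ C ↔ Monotone ν ∧ ∀ y, ν (J y) ≤ ‖y‖ := by simp [C]
  have C_closed : IsClosed C :=
    isClosed_monotone.inter (isClosed_iInter fun y => isClosed_le (by fun_prop) (by fun_prop))
  have isQuasistate {ν : C(K, ℝ) →ₗ[ℝ] ℝ} (hν : ⇑ν ∈ C) : IsQuasistate ν :=
    ⟨(mem_C.1 hν).1, hJe ▸ ((mem_C.1 hν).2 e).trans he⟩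
  have cofinal (f : C(K, ℝ)) : ∃ y, f ≤ J y :=
    ⟨‖f‖ • e, (le_norm_smul_one f).trans_eq (by rw [map_smul, hJe])⟩
  obtain ⟨ν, ν_continuous, ν_range⟩ := exists_cantorSet_continuous_range_eq C_closed norm
    (fun ν hν => (isQuasistate hν).apply_le_norm)
    ⟨0, mem_C.2 ⟨fun _ _ _ => le_rfl, fun y => norm_nonneg y⟩⟩
    (TopologicalSpace.denseSeq C(K, ℝ)) fun ν ν' hν hν' h => DFunLike.coe_injective <|
      (TopologicalSpace.denseRange_denseSeq _).equalizer (isQuasistate hν).continuous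
        (isQuasistate hν').continuous (funext h)
  have ν_mem (z : cantorSet) : ⇑(ν z) ∈ C := ν_range.subset (Set.mem_range_self z)
  refine ⟨ν, fun z => isQuasistate (ν_mem z), ν_continuous, fun z => (mem_C.1 (ν_mem z)).2,
    fun x => ?_⟩
  obtain ⟨ν', monotone, le_norm, apply_eq⟩ :=
    exists_monotone_linearMap_apply_eq_norm hJ hJ_inj cofinal (abs_nonneg x)
  obtain ⟨z, rfl⟩ := ν_range.superset (mem_C.2 ⟨monotone, le_norm⟩)
  exact ⟨z, by rw [← hJ.map_abs, apply_eq, norm_abs_eq_norm]⟩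

end Norming

section InitialSegments

variable (K : Type*) [TopologicalSpace K] [LinearOrder K]

/-- The continuous indicator functions of initial segments (lower sets) of `K`. -/
def initialSegments : Set C(K, ℝ) :=
  {f | Antitone f ∧ ∀ x, f x = 0 ∨ f x = 1}

variable {K}

theorem nonneg_of_mem_initialSegments {f : C(K, ℝ)} (hf : f ∈ initialSegments K) : 0 ≤ f :=
  fun x => (hf.2 x).elim Eq.ge fun h => zero_le_one.trans_eq h.symm

theorem le_one_of_mem_initialSegments {f : C(K, ℝ)} (hf : f ∈ initialSegments K) : f ≤ 1 :=
  fun x => (hf.2 x).elim (fun h => h.trans_le zero_le_one) Eq.le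

theorem initialSegments_mul {f g : C(K, ℝ)} (hf : f ∈ initialSegments K)
    (hg : g ∈ initialSegments K) : f * g ∈ initialSegments K := by
  refine ⟨fun x y hxy => ?_, fun x => ?_⟩ <;> rw [ContinuousMap.mul_apply]
  · exact mul_le_mul (hf.1 hxy) (hg.1 hxy) (nonneg_of_mem_initialSegments hg y)
      (nonneg_of_mem_initialSegments hf x)
  · rcases hf.2 x with hfx | hfx <;> rcases hg.2 x with hgx | hgx <;> simp [hfx, hgx]

theorem initialSegments_le_of_isLeast {f g : C(K, ℝ)} (hf : f ∈ initialSegments K)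
    (hg : g ∈ initialSegments K) {y : K} (hy : IsLeast {x | f x = 0} y) (hgy : g y = 0) :
    g ≤ f := fun x =>
  (hf.2 x).elim (fun hfx => ((hg.1 (hy.2 hfx)).trans_eq hgy).trans_eq hfx.symm)
    fun hfx => (le_one_of_mem_initialSegments hg x).trans_eq hfx.symm

variable [OrderClosedTopology K] [CompactSpace K]

theorem exists_covBy_of_lt [TotallyDisconnectedSpace K] {x y : K} (hxy : x < y) :
    ∃ a b, x ≤ a ∧ a ⋖ b ∧ b ≤ y := by
  obtain ⟨U, U_clopen, hxU, hyU⟩ := exists_isClopen_of_totally_separated hxy.ne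
  obtain ⟨a, ⟨haU, hay⟩, a_max⟩ :=
    (U_clopen.isClosed.inter isClosed_Iic).isCompact.exists_isGreatest ⟨x, hxU, hxy.le⟩
  obtain ⟨b, ⟨hbU, hab⟩, b_min⟩ :=
    (U_clopen.compl.isClosed.inter isClosed_Ici).isCompact.exists_isLeast ⟨y, hyU, hay⟩
  have hby : b ≤ y := b_min ⟨hyU, hay⟩
  refine ⟨a, b, a_max ⟨hxU, hxy.le⟩, ⟨hab.lt_of_ne fun h => hbU (h ▸ haU), fun c hac hcb => ?_⟩,
    hby⟩
  by_cases hc : c ∈ U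
  · exact hac.not_ge (a_max ⟨hc, hcb.le.trans hby⟩)
  · exact hcb.not_ge (b_min ⟨hc, hac.le⟩)

theorem exists_mem_initialSegments_of_lt [TotallyDisconnectedSpace K] {x y : K} (hxy : x < y) :
    ∃ f ∈ initialSegments K, f x = 1 ∧ f y = 0 := by
  obtain ⟨a, b, hxa, hab, hby⟩ := exists_covBy_of_lt hxy
  have Iic_clopen : IsClopen (Set.Iic a) := ⟨isClosed_Iic, hab.Iio_eq ▸ isOpen_Iio⟩
  refine ⟨⟨(Set.Iic a).indicator 1, Iic_clopen.continuous_indicator continuous_one⟩,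
    ⟨fun c d hcd => ?_, fun c => ?_⟩, Set.indicator_of_mem hxa 1,
    Set.indicator_of_notMem (hab.lt.trans_le hby).not_ge 1⟩
  · by_cases hd : d ≤ a
    · simp [hd, hcd.trans hd]
    · exact (Set.indicator_of_notMem hd 1).trans_le
        (Set.indicator_nonneg (fun _ _ => zero_le_one) c)
  · by_cases hc : c ≤ a <;> simp [hc]

theorem initialSegments_induction [TotallyDisconnectedSpace K] {p : C(K, ℝ) → Prop}
    (isClosed : IsClosed {f | p f}) (mem : ∀ f ∈ initialSegments K, p f)
    (add : ∀ f g, p f → p g → p (f + g)) (smul : ∀ (c : ℝ) f, p f → p (c • f)) (f : C(K, ℝ)) :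
    p f := by
  let M : Submonoid C(K, ℝ) :=
    { carrier := initialSegments K
      mul_mem' := initialSegments_mul
      one_mem' := ⟨fun _ _ _ => le_rfl, fun _ => Or.inr rfl⟩ }
  have separatesPoints : (Algebra.adjoin ℝ (M : Set C(K, ℝ))).SeparatesPoints := by
    intro x y hxy
    rcases hxy.lt_or_gt with hxy | hxy
    · obtain ⟨f, hf, hfx, hfy⟩ := exists_mem_initialSegments_of_lt hxy
      exact ⟨f, ⟨f, Algebra.subset_adjoin hf, rfl⟩, by simp [hfx, hfy]⟩
    · obtain ⟨f, hf, hfy, hfx⟩ := exists_mem_initialSegments_of_lt hxy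
      exact ⟨f, ⟨f, Algebra.subset_adjoin hf, rfl⟩, by simp [hfx, hfy]⟩
  have f_mem : f ∈ (Algebra.adjoin ℝ (M : Set C(K, ℝ))).topologicalClosure := by
    rw [ContinuousMap.subalgebra_topologicalClosure_eq_top_of_separatesPoints _ separatesPoints]
    exact Algebra.mem_top
  refine isClosed.closure_subset_iff.2 (fun g hg => ?_) f_mem
  change g ∈ Algebra.adjoin ℝ (M : Set C(K, ℝ)) at hg
  rw [← Subalgebra.mem_toSubmodule, Algebra.adjoin_eq_span,
    Submonoid.closure_eq] at hg
  induction hg using Submodule.span_induction with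
  | mem g hg => exact mem g hg
  | zero => simpa using smul 0 1 (mem 1 M.one_mem)
  | add g h _ _ hg hh => exact add g h hg hh
  | smul c g _ hg => exact smul c g hg

theorem exists_forall_apply_eq_one_iff [Nonempty K] {ν : C(K, ℝ) →ₗ[ℝ] ℝ} (hν : Monotone ν)
    {s : ℝ} (hs : 0 < s) (hs_le : s ≤ ν 1) :
    ∃ q : K, ∀ f ∈ initialSegments K, f q = 1 ↔ s ≤ ν f := by
  let Q : Set K := ⋂ f ∈ {f ∈ initialSegments K | s ≤ ν f}, {x | f x = 1}
  have Q_closed : IsClosed Q :=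
    isClosed_biInter fun f _ => isClosed_eq f.continuous continuous_const
  have Q_nonempty : Q.Nonempty := by
    obtain ⟨x, -, x_min⟩ := (isCompact_univ (X := K)).exists_isLeast Set.univ_nonempty
    refine ⟨x, Set.mem_iInter₂.2 fun f ⟨hf, hsf⟩ => (hf.2 x).resolve_left fun hfx => ?_⟩
    have f_nonpos : f ≤ 0 := fun y => (hf.1 (x_min (Set.mem_univ y))).trans_eq hfx
    exact (hs.trans_le hsf).not_ge ((hν f_nonpos).trans_eq ν.map_zero)
  obtain ⟨q, hq, q_max⟩ := Q_closed.isCompact.exists_isGreatest Q_nonempty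
  refine ⟨q, fun f hf => ⟨fun hfq => ?_, fun hsf => Set.mem_iInter₂.1 hq f ⟨hf, hsf⟩⟩⟩
  by_contra! ν_lt
  obtain ⟨x, hfx⟩ : ∃ x, f x = 0 := by
    by_contra! f_ne
    have f_eq : f = 1 := ContinuousMap.ext fun x => (hf.2 x).resolve_left (f_ne x)
    exact ν_lt.not_ge (f_eq ▸ hs_le)
  obtain ⟨y, hy⟩ :=
    (isClosed_eq f.continuous continuous_const).isCompact.exists_isLeast ⟨x, hfx⟩
  have y_notMem : y ∉ Q := fun hyQ =>
    one_pos.not_ge ((hfq.symm.trans_le (hf.1 (q_max hyQ))).trans_eq hy.1)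
  obtain ⟨g, ⟨hg, hsg⟩, hgy⟩ : ∃ g ∈ {f ∈ initialSegments K | s ≤ ν f}, g y ≠ 1 := by
    simpa only [Q, Set.mem_iInter₂, not_forall, exists_prop, Set.mem_ofPred_eq] using y_notMem
  have g_le_f := initialSegments_le_of_isLeast hf hg hy ((hg.2 y).resolve_right hgy)
  exact (hsg.trans (hν g_le_f)).not_gt ν_lt

/-- A family `ω` of Riesz homomorphisms, indexed by the real line with Lebesgue measure, which
disintegrates the positive functional `ν`. Only for initial segments `f` is `ω s f` prescribed: it
is the indicator of `s ∈ (0, ν f]`, so that `ω s` is the evaluation at the `s`-quantile of `ν`. -/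
structure IsQuantileFamily (ν : C(K, ℝ) →ₗ[ℝ] ℝ) (ω : ℝ → C(K, ℝ) →ₗ[ℝ] ℝ) : Prop where
  isRieszHom : ∀ s, IsRieszHom (ω s)
  abs_apply_le : ∀ s f, |ω s f| ≤ ‖f‖
  apply_initialSegment : ∀ s, ∀ f ∈ initialSegments K,
    ω s f = (Set.Ioc 0 (ν f)).indicator 1 s

theorem exists_isQuantileFamily [Nonempty K] {ν : C(K, ℝ) →ₗ[ℝ] ℝ} (hν : Monotone ν) :
    ∃ ω, IsQuantileFamily ν ω := by
  suffices exists_ω : ∀ s, ∃ ω : C(K, ℝ) →ₗ[ℝ] ℝ, IsRieszHom ω ∧ (∀ f, |ω f| ≤ ‖f‖) ∧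
      ∀ f ∈ initialSegments K, ω f = (Set.Ioc 0 (ν f)).indicator 1 s by
    choose ω isRieszHom abs_apply_le apply_initialSegment using exists_ω
    exact ⟨ω, isRieszHom, abs_apply_le, apply_initialSegment⟩
  intro s
  by_cases hs : s ∈ Set.Ioc 0 (ν 1)
  · obtain ⟨q, hq⟩ := exists_forall_apply_eq_one_iff hν hs.1 hs.2
    refine ⟨(ContinuousMap.evalCLM ℝ q).toLinearMap, fun _ _ => rfl, fun f => f.norm_coe_le_norm q,
      fun f hf => ?_⟩
    by_cases hsf : s ≤ ν f
    · exact ((hq f hf).2 hsf).trans (Set.indicator_of_mem (And.intro hs.1 hsf) 1).symm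
    · exact ((hf.2 q).resolve_right (mt (hq f hf).1 hsf)).trans
        (Set.indicator_of_notMem (mt And.right hsf) 1).symm
  · refine ⟨0, fun _ _ => (sup_idem 0).symm, fun f => by simp, fun f hf => ?_⟩
    have ν_le : ν f ≤ ν 1 := hν (le_one_of_mem_initialSegments hf)
    exact (Set.indicator_of_notMem (mt (fun h => ⟨h.1, h.2.trans ν_le⟩) hs) 1).symm

variable [TotallyDisconnectedSpace K] {ν : C(K, ℝ) →ₗ[ℝ] ℝ} {ω : ℝ → C(K, ℝ) →ₗ[ℝ] ℝ}

theorem IsQuantileFamily.measurable (hω : IsQuantileFamily ν ω) (f : C(K, ℝ)) :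
    Measurable fun s => ω s f := by
  have ω_continuous (s : ℝ) : Continuous (ω s) :=
    AddMonoidHomClass.continuous_of_bound (ω s) 1 fun f =>
      (hω.abs_apply_le s f).trans_eq (one_mul _).symm
  induction f using initialSegments_induction with
  | isClosed =>
    refine IsSeqClosed.isClosed fun g f hg hgf => measurable_of_tendsto_metrizable hg ?_
    exact tendsto_pi_nhds.2 fun s => ((ω_continuous s).tendsto f).comp hgf
  | mem f hf =>
    simp only [hω.apply_initialSegment _ f hf]
    exact measurable_one.indicator measurableSet_Ioc
  | add f g hf hg => simp only [map_add]; exact hf.add hg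
  | smul c f hf => simp only [map_smul]; exact hf.const_mul c

end InitialSegments

section QuantileTransform

open Filter Topology

theorem exists_continuousLinearMap_L1_coeFn_ae_eq {α E : Type*} [MeasurableSpace α]
    {μ : Measure α} [IsProbabilityMeasure μ] [SeminormedAddCommGroup E] [NormedSpace ℝ E]
    {ω : α → E →ₗ[ℝ] ℝ} (ω_measurable : ∀ f, Measurable fun s => ω s f)
    (abs_ω_le : ∀ s f, |ω s f| ≤ ‖f‖) :
    ∃ Φ : E →L[ℝ] Lp ℝ 1 μ, ∀ f, Φ f =ᵐ[μ] fun s => ω s f := by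
  have ω_integrable (f : E) : Integrable (fun s => ω s f) μ :=
    .of_bound (ω_measurable f).aestronglyMeasurable ‖f‖ (ae_of_all μ fun s => abs_ω_le s f)
  let Φ : E →ₗ[ℝ] Lp ℝ 1 μ :=
    { toFun f := (ω_integrable f).toL1
      map_add' f g := by simp only [map_add]; exact Integrable.toL1_add _ _ _ _
      map_smul' c f := by simp only [map_smul]; exact Integrable.toL1_smul _ _ c }
  refine ⟨Φ.mkContinuous 1 fun f => ?_, fun f => (ω_integrable f).coeFn_toL1⟩
  calc ‖Φ f‖ = ∫ s, ‖ω s f‖ ∂μ := L1.norm_of_fun_eq_integral_norm (ω_integrable f)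
    _ ≤ ∫ _, ‖f‖ ∂μ :=
      integral_mono (ω_integrable f).norm (integrable_const _) fun s => abs_ω_le s f
    _ = 1 * ‖f‖ := by simp

/-- The indicator of `[0, t]` as an element of `L₁[0,1]`. -/
noncomputable def stepL1 (t : ℝ) : L1Interval :=
  ((integrable_const (1 : ℝ)).indicator (measurableSet_Iic (a := t))).toL1

theorem continuous_stepL1 : Continuous stepL1 :=
  continuous_toL1_indicator_Iic (integrable_const 1)

theorem integral_stepL1 {t : ℝ} (ht : t ∈ Set.Icc 0 1) :
    ∫ s in Set.Icc (0 : ℝ) 1, stepL1 t s = t := by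
  have inter_eq : Set.Iic t ∩ Set.Icc 0 1 = Set.Icc 0 t :=
    Set.ext fun s => ⟨fun hs => ⟨hs.2.1, hs.1⟩, fun hs => ⟨hs.2, hs.1, hs.2.trans ht.2⟩⟩
  rw [stepL1, integral_congr_ae (Integrable.coeFn_toL1 _), integral_indicator measurableSet_Iic,
    Measure.restrict_restrict measurableSet_Iic, inter_eq]
  simp [ht.1]

variable {K : Type*} [TopologicalSpace K] [LinearOrder K] [OrderClosedTopology K] [CompactSpace K]
  [TotallyDisconnectedSpace K] [Nonempty K]

theorem IsQuasistate.exists_isRieszHom_L1 {ν : C(K, ℝ) →ₗ[ℝ] ℝ} (hν : IsQuasistate ν) :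
    ∃ Φ : C(K, ℝ) →L[ℝ] L1Interval, IsRieszHom Φ.toLinearMap ∧ (∀ f, ‖Φ f‖ = ν |f|) ∧
      ∀ f ∈ initialSegments K, Φ f = stepL1 (ν f) := by
  have : IsProbabilityMeasure (volume.restrict (Set.Icc (0 : ℝ) 1)) := ⟨by simp⟩
  obtain ⟨ω, hω⟩ := exists_isQuantileFamily hν.monotone
  obtain ⟨Φ, Φ_eq⟩ := exists_continuousLinearMap_L1_coeFn_ae_eq
    (μ := volume.restrict (Set.Icc (0 : ℝ) 1)) hω.measurable hω.abs_apply_le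
  have Φ_isRieszHom : IsRieszHom Φ.toLinearMap := fun f g => Lp.ext <| by
    filter_upwards [Φ_eq (f ⊔ g), Φ_eq f, Φ_eq g, Lp.coeFn_sup (Φ f) (Φ g)]
      with s sup_eq f_eq g_eq coeFn_sup
    exact sup_eq.trans ((hω.isRieszHom s f g).trans (coeFn_sup.trans (by simp [f_eq, g_eq])).symm)
  have Φ_initialSegment (f : C(K, ℝ)) (hf : f ∈ initialSegments K) : Φ f = stepL1 (ν f) := by
    refine Lp.ext ?_
    filter_upwards [Φ_eq f, Integrable.coeFn_toL1 ((integrable_const (1 : ℝ)).indicator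
      (measurableSet_Iic (a := ν f))), ae_restrict_mem measurableSet_Icc,
      Measure.ae_ne _ 0] with s f_eq step_eq s_mem s_ne
    rw [f_eq, stepL1, step_eq, hω.apply_initialSegment s f hf]
    exact Set.indicator_eq_indicator (by simp [s_mem.1.lt_of_ne' s_ne]) rfl
  have integral_Φ (f : C(K, ℝ)) : ∫ s in Set.Icc (0 : ℝ) 1, Φ f s = ν f := by
    have integral_continuous := continuous_integral.comp Φ.continuous
    induction f using initialSegments_induction with
    | isClosed => exact isClosed_eq integral_continuous hν.continuous
    | mem f hf =>
      rw [Φ_initialSegment f hf]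
      refine integral_stepL1 ⟨?_, (hν.monotone (le_one_of_mem_initialSegments hf)).trans
        hν.apply_one_le⟩
      exact ν.map_zero.symm.trans_le (hν.monotone (nonneg_of_mem_initialSegments hf))
    | add f g hf hg =>
      rw [map_add, map_add, ← hf, ← hg, integral_congr_ae (Lp.coeFn_add _ _)]
      exact integral_add (L1.integrable_coeFn _) (L1.integrable_coeFn _)
    | smul c f hf =>
      rw [map_smul, map_smul, ← hf, integral_congr_ae (Lp.coeFn_smul _ _)]
      exact integral_const_mul _ _
  refine ⟨Φ, Φ_isRieszHom, fun f => ?_, Φ_initialSegment⟩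
  rw [L1.norm_eq_integral_norm, ← integral_Φ]
  have abs_eq : Φ |f| = |Φ f| := Φ_isRieszHom.map_abs f
  rw [abs_eq]
  exact integral_congr_ae (Lp.coeFn_abs _).symm

theorem exists_isRieszHom_continuousMap_L1 {Z : Type*} [TopologicalSpace Z]
    {ν : Z → C(K, ℝ) →ₗ[ℝ] ℝ} (hν : ∀ z, IsQuasistate (ν z))
    (ν_continuous : ∀ f, Continuous fun z => ν z f) :
    ∃ T : C(K, ℝ) →ₗ[ℝ] C(Z, L1Interval), IsRieszHom T ∧ ∀ f z, ‖T f z‖ = ν z |f| := by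
  choose Φ Φ_isRieszHom norm_Φ Φ_initialSegment using fun z => (hν z).exists_isRieszHom_L1
  have Φ_lipschitz (z : Z) : LipschitzWith 1 (Φ z) :=
    (Φ z).lipschitzWith_of_opNorm_le <| (Φ z).opNorm_le_bound zero_le_one fun f => by
      have norm_abs_le : ‖|f|‖ ≤ ‖f‖ := (ContinuousMap.norm_le _ (norm_nonneg f)).2 fun x =>
        (norm_abs_eq_norm (f x)).trans_le (f.norm_coe_le_norm x)
      rw [norm_Φ, NNReal.coe_one, one_mul]
      exact ((hν z).apply_le_norm |f|).trans norm_abs_le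
  have Φ_continuous (f : C(K, ℝ)) : Continuous fun z => Φ z f := by
    induction f using initialSegments_induction with
    | isClosed =>
      have equicontinuous := (LipschitzWith.uniformEquicontinuous _ 1 Φ_lipschitz).equicontinuous
      simp only [continuous_iff_continuousAt, Set.ofPred_forall]
      exact isClosed_iInter fun z => equicontinuous.isClosed_setOfPred_tendsto (Φ z).continuous
    | mem f hf =>
      simp only [Φ_initialSegment _ f hf]
      exact continuous_stepL1.comp (ν_continuous f)
    | add f g hf hg => simp only [map_add]; exact hf.add hg
    | smul c f hf => simp only [map_smul]; exact hf.const_smul c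
  refine ⟨
    { toFun f := ⟨fun z => Φ z f, Φ_continuous f⟩
      map_add' f g := ContinuousMap.ext fun z => map_add (Φ z) f g
      map_smul' c f := ContinuousMap.ext fun z => map_smul (Φ z) c f }, fun f g =>
      ContinuousMap.ext fun z => Φ_isRieszHom z f g, fun f z => norm_Φ z f⟩

end QuantileTransform

section RieszSpan

variable {X : Type*} [AddCommGroup X] [Module ℝ X] [Lattice X]

/-- The Riesz subspace (vector sublattice) generated by a set. It is enough to require closure under
suprema, since `x ⊓ y = -(-x ⊔ -y)`. -/
def rieszSpan (s : Set X) : Submodule ℝ X :=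
  sInf {S | s ⊆ S ∧ SupClosed (S : Set X)}

variable {s : Set X}

theorem subset_rieszSpan : s ⊆ rieszSpan s := fun _ hx =>
  Submodule.mem_sInf.2 fun _ hS => hS.1 hx

theorem rieszSpan_le {S : Submodule ℝ X} (hs : s ⊆ S) (hS : SupClosed (S : Set X)) :
    rieszSpan s ≤ S :=
  sInf_le ⟨hs, hS⟩

theorem supClosed_rieszSpan : SupClosed (rieszSpan s : Set X) := fun _ hx _ hy =>
  Submodule.mem_sInf.2 fun S hS =>
    hS.2 (Submodule.mem_sInf.1 hx S hS) (Submodule.mem_sInf.1 hy S hS)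

variable [IsOrderedAddMonoid X]

theorem infClosed_rieszSpan : InfClosed (rieszSpan s : Set X) := fun x hx y hy => by
  rw [← neg_neg (x ⊓ y), neg_inf]
  exact neg_mem (supClosed_rieszSpan (neg_mem hx) (neg_mem hy))

instance rieszSpan.instLattice : Lattice (rieszSpan s) :=
  Subtype.lattice (fun _ _ hx hy => supClosed_rieszSpan hx hy)
    fun _ _ hx hy => infClosed_rieszSpan hx hy

instance rieszSpan.instIsOrderedModule [IsOrderedModule ℝ X] :
    IsOrderedModule ℝ (rieszSpan s) where
  smul_le_smul_of_nonneg_left _ hc x y hxy :=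
    smul_le_smul_of_nonneg_left (α := ℝ) (β := X) (show (x : X) ≤ y from hxy) hc
  smul_le_smul_of_nonneg_right x hx _ _ hcd :=
    smul_le_smul_of_nonneg_right (α := ℝ) (β := X) hcd (show (0 : X) ≤ x from hx)

theorem IsRieszHom.ext_rieszSpan {W : Type*} [AddCommGroup W] [Module ℝ W] [Lattice W]
    {S T : rieszSpan s →ₗ[ℝ] W} (hS : IsRieszHom S) (hT : IsRieszHom T)
    (hST : ∀ x (hx : x ∈ s), S ⟨x, subset_rieszSpan hx⟩ = T ⟨x, subset_rieszSpan hx⟩) : S = T := by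
  have rieszSpan_le_map : rieszSpan s ≤ (S.eqLocus T).map (rieszSpan s).subtype := by
    refine rieszSpan_le (fun x hx => ⟨_, hST x hx, rfl⟩) ?_
    rintro _ ⟨x, hx, rfl⟩ _ ⟨y, hy, rfl⟩
    exact ⟨x ⊔ y, (hS x y).trans ((congrArg₂ _ hx hy).trans (hT x y).symm), rfl⟩
  refine LinearMap.ext fun x => ?_
  obtain ⟨y, hy, hyx⟩ := rieszSpan_le_map x.2
  exact Subtype.ext hyx ▸ hy

theorem exists_le_smul_of_mem_rieszSpan [IsOrderedModule ℝ X] {e : X} (he : 0 ≤ e)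
    (hs : ∀ x ∈ s, ∃ c : ℝ, |x| ≤ c • e) {x : X} (hx : x ∈ rieszSpan s) :
    ∃ c : ℝ, x ≤ c • e := by
  have smul_le (c : ℝ) (x : X) : c • x ≤ |c| • |x| := by
    rcases le_total 0 c with hc | hc
    · rw [abs_of_nonneg hc]
      exact smul_le_smul_of_nonneg_left (le_abs_self x) hc
    · rw [abs_of_nonpos hc, ← neg_smul_neg]
      exact smul_le_smul_of_nonneg_left (neg_le_abs x) (neg_nonneg.2 hc)
  let I : Submodule ℝ X :=
    { carrier := {x | ∃ c : ℝ, |x| ≤ c • e}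
      zero_mem' := ⟨0, by simp⟩
      add_mem' := by
        rintro x y ⟨c, hx⟩ ⟨d, hy⟩
        exact ⟨c + d, (abs_add_le x y).trans ((add_le_add hx hy).trans_eq (add_smul c d e).symm)⟩
      smul_mem' := by
        rintro a x ⟨c, hx⟩
        have abs_smul_le : |a • x| ≤ |a| • |x| := by
          refine abs_le'.2 ⟨smul_le a x, ?_⟩
          simpa only [neg_smul, abs_neg] using smul_le (-a) x
        refine ⟨|a| * c, abs_smul_le.trans ?_⟩
        rw [mul_smul]
        exact smul_le_smul_of_nonneg_left hx (abs_nonneg a) }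
  have I_supClosed : SupClosed (I : Set X) := by
    rintro x ⟨c, hx⟩ y ⟨d, hy⟩
    have hx' := hx.trans (smul_le_smul_of_nonneg_right (le_max_left c d) he)
    have hy' := hy.trans (smul_le_smul_of_nonneg_right (le_max_right c d) he)
    refine ⟨max c d, abs_le'.2 ⟨sup_le ((le_abs_self x).trans hx') ((le_abs_self y).trans hy'), ?_⟩⟩
    exact (neg_le_neg le_sup_left).trans ((neg_le_abs x).trans hx')
  obtain ⟨c, hc⟩ := rieszSpan_le (S := I) hs I_supClosed hx
  exact ⟨c, (le_abs_self x).trans hc⟩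

end RieszSpan

section Embedding

variable {X : Type u} [NormedAddCommGroup X] [NormedSpace ℝ X] [Lattice X]

instance rieszSpan.instHasSolidNorm [HasSolidNorm X] [IsOrderedAddMonoid X] {s : Set X} :
    HasSolidNorm (rieszSpan s) where
  solid _ _ h := HasSolidNorm.solid (α := X) h

theorem nonpos_of_forall_le_smul [ClosedIciTopology X] {e x : X}
    (hx : ∀ ε : ℝ, 0 < ε → x ≤ ε • e) : x ≤ 0 := by
  have tendsto_zero : Filter.Tendsto (fun ε : ℝ => ε • e) (nhdsWithin 0 (Set.Ioi 0)) (nhds 0) :=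
    tendsto_nhdsWithin_of_tendsto_nhds (Continuous.tendsto' (by fun_prop) _ _ (zero_smul ℝ e))
  refine ge_of_tendsto tendsto_zero ?_
  filter_upwards [self_mem_nhdsWithin] with ε hε using hx ε hε

theorem isArchimedeanOrderUnit_rieszSpan [ClosedIciTopology X] [IsOrderedAddMonoid X]
    [IsOrderedModule ℝ X] {s : Set X} {e : X} (he : 0 ≤ e) (hes : e ∈ s)
    (hs : ∀ x ∈ s, ∃ c : ℝ, |x| ≤ c • e) :
    IsArchimedeanOrderUnit (⟨e, subset_rieszSpan hes⟩ : rieszSpan s) where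
  nonneg := he
  exists_le_smul x := exists_le_smul_of_mem_rieszSpan he hs x.2
  nonpos_of_forall_le_smul _ hx := nonpos_of_forall_le_smul (X := X) (e := e) hx

theorem exists_isLatticeIsometricEmbedding_of_dense_rieszSpan [HasSolidNorm X]
    [IsOrderedAddMonoid X] {Y : Type v} [NormedAddCommGroup Y] [NormedSpace ℝ Y] [Lattice Y]
    [IsBanachLattice Y] {s : Set X} (hs : Dense (rieszSpan s : Set X)) {T : rieszSpan s →ₗ[ℝ] Y}
    (hT : IsRieszHom T) (norm_T : ∀ x, ‖T x‖ = ‖x‖) :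
    ∃ T' : X →L[ℝ] Y, IsLatticeIsometricEmbedding T' := by
  let T' := T.extendOfNorm (rieszSpan s).subtype
  have denseRange : DenseRange (rieszSpan s).subtype := hs.denseRange_val
  have T'_eq (x : rieszSpan s) : T' x = T x :=
    LinearMap.extendOfNorm_eq denseRange ⟨1, fun x => (norm_T x).trans_le (one_mul _).ge⟩ x
  refine ⟨T', AddMonoidHomClass.isometry_of_norm T' fun x => ?_,
    isLatticeHomomorphism_of_isRieszHom fun x y => ?_⟩
  · refine denseRange.induction_on x (isClosed_eq (by fun_prop) (by fun_prop)) fun y => ?_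
    exact (congrArg norm (T'_eq y)).trans (norm_T y)
  · refine denseRange.induction_on₂ (p := fun x y => T' (x ⊔ y) = T' x ⊔ T' y)
      (isClosed_eq (by fun_prop) (by fun_prop)) (fun x y => ?_) x y
    exact (T'_eq (x ⊔ y)).trans ((hT x y).trans (congrArg₂ _ (T'_eq x).symm (T'_eq y).symm))

theorem IsArchimedeanOrderUnit.exists_isRieszHom_norm_eq [HasSolidNorm X] [IsOrderedAddMonoid X]
    [IsOrderedModule ℝ X] {e : X} (he : IsArchimedeanOrderUnit e) (norm_e : ‖e‖ ≤ 1) (u : ℕ → X)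
    (hu : ∀ ω ω' : X →ₗ[ℝ] ℝ, IsRieszHom ω → IsRieszHom ω' → ω e = ω' e →
      (∀ n, ω (u n) = ω' (u n)) → ω = ω') :
    ∃ T : X →ₗ[ℝ] CantorL1, IsRieszHom T ∧ ∀ x, ‖T x‖ = ‖x‖ := by
  have : TotallyDisconnectedSpace cantorSet :=
    cantorSetHomeomorphNatToBool.symm.totallyDisconnectedSpace
  have : Nonempty cantorSet := ⟨⟨0, zero_mem_cantorSet⟩⟩
  rcases subsingleton_or_nontrivial X with _ | _
  · exact ⟨0, fun x y => by simp, fun x => by simp [Subsingleton.elim x 0]⟩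
  obtain ⟨J, hJ, hJe, hJ_inj⟩ := he.exists_injective_isRieszHom_cantorSet u hu
  obtain ⟨ν, hν, ν_continuous, ν_le, ν_norming⟩ :=
    exists_cantorSet_quasistates_norming hJ hJ_inj hJe norm_e
  obtain ⟨S, hS, norm_S⟩ := exists_isRieszHom_continuousMap_L1 hν ν_continuous
  refine ⟨S ∘ₗ J, fun x y => (congrArg S (hJ x y)).trans (hS _ _), fun x => le_antisymm ?_ ?_⟩
  · refine (ContinuousMap.norm_le _ (norm_nonneg x)).2 fun z => ?_
    calc ‖S (J x) z‖ = ν z (J |x|) := by rw [norm_S, hJ.map_abs]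
      _ ≤ ‖x‖ := (ν_le z |x|).trans_eq (norm_abs_eq_norm x)
  · obtain ⟨z, hz⟩ := ν_norming x
    calc ‖x‖ = ‖S (J x) z‖ := by rw [← hz, norm_S]
      _ ≤ ‖S (J x)‖ := ContinuousMap.norm_coe_le_norm _ z

variable [IsBanachLattice X]

theorem exists_forall_abs_le_smul (x : ℕ → X) :
    ∃ e : X, 0 ≤ e ∧ ‖e‖ ≤ 1 ∧ ∀ n, ∃ c : ℝ, |x n| ≤ c • e := by
  let a (n : ℕ) : ℝ := 1 / 2 / 2 ^ n * (1 + ‖x n‖)⁻¹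
  have a_pos (n : ℕ) : 0 < a n := by positivity
  have smul_nonneg (n : ℕ) : 0 ≤ a n • |x n| := smul_nonneg (a_pos n).le (abs_nonneg _)
  have norm_smul_le (n : ℕ) : ‖a n • |x n|‖ ≤ 1 / 2 / 2 ^ n := by
    rw [norm_smul, norm_abs_eq_norm, Real.norm_of_nonneg (a_pos n).le, mul_assoc]
    refine mul_le_of_le_one_right (by positivity) ?_
    rw [inv_mul_le_iff₀ (by positivity)]
    linarith
  have hasSum := hasSum_geometric_two' (1 : ℝ)
  have summable : Summable fun n => a n • |x n| := .of_norm_bounded hasSum.summable norm_smul_le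
  refine ⟨∑' n, a n • |x n|, tsum_nonneg smul_nonneg, tsum_of_norm_bounded hasSum norm_smul_le,
    fun n => ⟨(a n)⁻¹, ?_⟩⟩
  rw [le_inv_smul_iff_of_pos (a_pos n)]
  exact summable.le_tsum n fun m _ => smul_nonneg m

theorem exists_isLatticeIsometricEmbedding_cantorL1 [TopologicalSpace.SeparableSpace X] :
    ∃ T : X →L[ℝ] CantorL1, IsLatticeIsometricEmbedding T := by
  let x := TopologicalSpace.denseSeq X
  obtain ⟨e, e_nonneg, norm_e, x_le⟩ := exists_forall_abs_le_smul x
  let s : Set X := insert e (Set.range x)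
  have he : e ∈ s := Set.mem_insert e _
  have hx (n : ℕ) : x n ∈ s := Set.mem_insert_of_mem e ⟨n, rfl⟩
  have s_le : ∀ y ∈ s, ∃ c : ℝ, |y| ≤ c • e := by
    rintro _ (rfl | ⟨n, rfl⟩)
    · exact ⟨1, by rw [abs_of_nonneg e_nonneg, one_smul]⟩
    · exact x_le n
  obtain ⟨T, hT, norm_T⟩ :=
    (isArchimedeanOrderUnit_rieszSpan e_nonneg he s_le).exists_isRieszHom_norm_eq norm_e
      (fun n => ⟨x n, subset_rieszSpan (hx n)⟩) fun ω ω' hω hω' ωe ωx =>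
        hω.ext_rieszSpan hω' <| by
          rintro _ (rfl | ⟨n, rfl⟩)
          exacts [ωe, ωx n]
  refine exists_isLatticeIsometricEmbedding_of_dense_rieszSpan ?_ hT norm_T
  exact (TopologicalSpace.denseRange_denseSeq X).mono
    ((Set.subset_insert e _).trans subset_rieszSpan)

end Embedding

theorem mainTheorem10_general :
    (∀ (X : Type u) [NormedAddCommGroup X] [NormedSpace ℝ X] [Lattice X] [TopologicalLattice X]
        [IsOrderedAddMonoid X] (K : Type v) [TopologicalSpace K] [CompactSpace K],
        RealLatticeHom X = {0} → RealLatticeHom C(K, X) = {0}) ∧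
      IsBanachLattice CantorL1 ∧
      RealLatticeHom CantorL1 = {0} ∧
      (∀ (X : Type w) [NormedAddCommGroup X] [NormedSpace ℝ X] [Lattice X] [IsBanachLattice X]
        [TopologicalSpace.SeparableSpace X],
        ∃ T : X →L[ℝ] CantorL1, IsLatticeIsometricEmbedding T) :=
  ⟨fun _ _ _ _ _ _ _ _ _ hX => realLatticeHom_continuousMap_eq_zero hX, inferInstance,
    realLatticeHom_continuousMap_eq_zero realLatticeHom_L1_eq_zero,
    fun _ _ _ _ _ _ => exists_isLatticeIsometricEmbedding_cantorL1⟩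

theorem mainTheorem10 :
    (∀ (X : Type u) [NormedAddCommGroup X] [NormedSpace ℝ X] [Lattice X] [IsBanachLattice X]
        (K : Type v) [TopologicalSpace K] [CompactSpace K] [T2Space K],
        RealLatticeHom X = {0} → RealLatticeHom C(K, X) = {0}) ∧
      IsBanachLattice CantorL1 ∧
      RealLatticeHom CantorL1 = {0} ∧
      (∀ (X : Type w) [NormedAddCommGroup X] [NormedSpace ℝ X] [Lattice X] [IsBanachLattice X]
        [TopologicalSpace.SeparableSpace X],
        ∃ T : X →L[ℝ] CantorL1, IsLatticeIsometricEmbedding T) :=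
  ⟨fun X _ _ _ _ K _ _ _ => mainTheorem10_general.{u, v, w}.1 X K,
    mainTheorem10_general.{u, v, w}.2⟩
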